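/- Let $\mathbb K\in\{\mathbb R,\mathbb C\}$ and let $A$ be a $\mathbb K$-algebra with unit that is complete with respect to a submultiplicative norm $\|\cdot\|$ (the norm of the unit need not be $1$); for example, $A=\mathbb K^{n\times n}$ with any submultiplicative matrix norm. For a word $w$ in two noncommuting letters $x,y$ let $g_w\in\mathbb Q$ be the Goldberg coefficient, i.e. the coefficient of $w$ in the formal solution $\log(e^{x}e^{y})=\sum_{n\ge 1}\frac{(-1)^{n-1}}{n}(e^{x}e^{y}-1)^n$ of $e^{x}e^{y}=e^{z}$, and for $X,Y\in A$ put $z_k(X,Y)=\sum_{|w|=k} g_w\, w(X,Y)$, where the sum is over all words of length $k$ and $w(X,Y)\in A$ is the product obtained from $w$ by substituting $X$ for $x$ and $Y$ for $y$. Let $0<\mu<1$ and let $X,Y\in A$ with $\|X\|,\|Y\|\le\mu$. Then $\|z_k(X,Y)\|\le\mu^k$ for all $k\ge 2$. Consequently the Goldberg series $$Z = X+Y+\sum_{k=2}^\infty z_k(X,Y)$$ converges absolutely; moreover its sum satisfies $\exp(X)\exp(Y)=\exp(Z)$, and $$\|Z\| < \|X\|+\|Y\|+\sum_{k=2}^\infty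 \mu^k .$$ -/

import Mathlib

/-- A formal power series with rational coefficients in two noncommuting variables, given by its
coefficients. Words are lists over the alphabet `Fin 2`, where `0` is the letter `X` and `1` is the
letter `Y`. -/
abbrev NCSeries : Type := List (Fin 2) → ℚ

namespace NCSeries

/-- The series `1`. -/
def one : NCSeries := fun w => if w = [] then 1 else 0

/-- The series consisting of the single letter `a`. -/
def letter (a : Fin 2) : NCSeries := fun w => if w = [a] then 1 else 0

/-- The product induced by concatenation of words: sum over all factorizations `w = u v`. -/
def mul (f g : NCSeries) : NCSeries := fun w =>
  ∑ i ∈ Finset.range (w.length + 1), f (w.take i) * g (w.drop i)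

/-- Powers of a series. -/
def pow (f : NCSeries) : ℕ → NCSeries
  | 0 => one
  | n + 1 => mul f (pow f n)

/-- The formal exponential `∑ₙ fⁿ / n!` of a series `f` without constant term. As `fⁿ` has no words
of length `< n`, only `n ≤ |w|` contributes to the coefficient of `w`. -/
def exp (f : NCSeries) : NCSeries := fun w =>
  ∑ n ∈ Finset.range (w.length + 1), (1 / (n.factorial : ℚ)) * pow f n w

/-- The formal logarithm `∑_{n ≥ 1} (-1)ⁿ⁻¹ (f - 1)ⁿ / n` of a series `f` with constant term `1`.
As `(f - 1)ⁿ` has no words of length `< n`, only `n ≤ |w|` contributes to the coefficient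
of `w`. -/
def log (f : NCSeries) : NCSeries := fun w =>
  ∑ n ∈ Finset.Icc 1 w.length, ((-1 : ℚ) ^ (n - 1) / (n : ℚ)) * pow (f - one) n w

end NCSeries

/-- The Goldberg coefficient `g_w`: the coefficient of the word `w` in the formal solution
`Z = log (exp X exp Y)` of `exp X exp Y = exp Z`. -/
def goldbergCoeff : List (Fin 2) → ℚ :=
  NCSeries.log
    (NCSeries.mul (NCSeries.exp (NCSeries.letter 0)) (NCSeries.exp (NCSeries.letter 1)))

/-- The homogeneous part `z_k(X, Y) = ∑_{|w| = k} g_w w` of the Goldberg series, each word being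
evaluated at the elements `X`, `Y` of a `𝕜`-algebra. -/
def goldbergTerm (𝕜 : Type*) {A : Type*} [RCLike 𝕜] [Ring A] [Algebra 𝕜 A] (X Y : A) (k : ℕ) : A :=
  ∑ w : Fin k → Fin 2,
    ((goldbergCoeff (List.ofFn w) : ℚ) : 𝕜) • (List.ofFn fun i => ![X, Y] (w i)).prod

/-- The sum `Z = X + Y + ∑_{k ≥ 2} z_k(X, Y)` of the Goldberg series. -/
noncomputable def goldbergSeries (𝕜 : Type*) {A : Type*} [RCLike 𝕜] [NormedRing A]
    [NormedAlgebra 𝕜 A] (X Y : A) : A :=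
  X + Y + ∑' k : ℕ, goldbergTerm 𝕜 X Y (k + 2)

/-! Let T be a central variable counting word length and U = e^{xT} e^{yT} - 1. Then z_k is the
T^k-coefficient of log(1 + U) = ∫_0^1 U (1 + tU)⁻¹ dt, so for k ≥ 4 it suffices to bound that
coefficient of the integrand by μ^k for each 0 < t ≤ 1.

Put q = t(1 - t), f = (e^T - 1)/(1 + t(e^T - 1)), a = f(xT), b = f(yT). The element 1 + tU factors
around 1 + q ab (`resolvent_identity`), so the integrand is a combination of alternating words in a
and b. Replacing a and b by c(μT), where c has coefficients |f_k|, majorizes it by s + e with s =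
2c/(1 - qc²), e = c²/(1 - qc²).

The Riccati equation f' = 1 + (1 - 2t)f - qf² yields, coefficientwise, c' ≤ 1 + uc + qc² with u = |1
- 2t|, hence a coupled system of inequalities for s and e. In positive degrees it implies p' ≤ 2p +
p²/2 for p = s + e. Low-degree estimates and induction give p_k ≤ 1 for k ≥ 4
(`coeff_majorant_le_one`).

In degrees 2 and 3 the majorant exceeds 1 for small t; there the commutator formulas give μ² and
(2/3)μ³, the latter making the final inequality strict. Absolute convergence then turns the formal
identity exp(log(1 + U)) = 1 + U into an identity in A. -/

section

open PowerSeries Finset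

/-! ### Substitution into scalar power series over a noncommutative algebra -/

section FormalSubstitution

variable {K A : Type*} [CommRing K] [Ring A] [Algebra K A]

/-- The power series `∑ₙ fₙ Uⁿ` over a noncommutative algebra, for `U` without constant term. -/
noncomputable def subNC (U : A⟦X⟧) (f : K⟦X⟧) : A⟦X⟧ :=
  PowerSeries.mk fun k => ∑ n ∈ range (k + 1), coeff n f • coeff k (U ^ n)

theorem coeff_pow_eq_zero_of_lt {U : A⟦X⟧} (hU : constantCoeff U = 0) {k n : ℕ} (h : k < n) :
    coeff k (U ^ n) = 0 := by
  obtain ⟨V, rfl⟩ := X_dvd_iff.mpr hU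
  rw [Commute.mul_pow (commute_X V).symm, coeff_X_pow_mul', if_neg (by omega)]

theorem coeff_subNC {U : A⟦X⟧} (hU : constantCoeff U = 0) (f : K⟦X⟧) {k N : ℕ} (h : k < N) :
    coeff k (subNC U f) = ∑ n ∈ range N, coeff n f • coeff k (U ^ n) := by
  rw [subNC, coeff_mk]
  refine sum_subset (by intro x; simp; omega) fun n _ hn => ?_
  rw [coeff_pow_eq_zero_of_lt hU (by simpa using hn), smul_zero]

theorem subNC_one (U : A⟦X⟧) : subNC U (1 : K⟦X⟧) = 1 := by
  ext k
  rw [subNC, coeff_mk, sum_eq_single 0]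
  · simp
  · intro b _ hb; simp [coeff_one, hb]
  · simp

theorem subNC_add (U : A⟦X⟧) (f g : K⟦X⟧) : subNC U (f + g) = subNC U f + subNC U g := by
  ext k
  simp [subNC, add_smul, sum_add_distrib]

/-- Only powers of the single element U occur, and they commute with each other and with scalars, so
noncommutativity of A does no harm. -/
theorem subNC_mul {U : A⟦X⟧} (hU : constantCoeff U = 0) (f g : K⟦X⟧) :
    subNC U (f * g) = subNC U f * subNC U g := by
  ext k
  have hbox : ∀ n ∈ range (k + 1), ∀ m ∈ range (k + 1),
      ∑ p ∈ antidiagonal k, (coeff n f * coeff m g) • (coeff p.1 (U ^ n) * coeff p.2 (U ^ m)) =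
        (coeff n f * coeff m g) • coeff k (U ^ (n + m)) := by
    intro n _ m _
    rw [pow_add, coeff_mul, smul_sum]
  have hR : coeff k (subNC U f * subNC U g) = ∑ n ∈ range (k + 1), ∑ m ∈ range (k + 1),
      (coeff n f * coeff m g) • coeff k (U ^ (n + m)) := by
    rw [coeff_mul, ← sum_congr rfl fun n hn => sum_congr rfl (hbox n hn)]
    simp_rw [sum_comm (s := range (k + 1)) (t := antidiagonal k)]
    refine sum_congr rfl fun p hp => ?_
    rw [HasAntidiagonal.mem_antidiagonal] at hp
    rw [coeff_subNC hU f (show p.1 < k + 1 by omega), coeff_subNC hU g (show p.2 < k + 1 by omega),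
      sum_mul_sum]
    simp_rw [smul_mul_smul_comm]
  have hL : coeff k (subNC U (f * g)) = ∑ l ∈ range (k + 1), ∑ p ∈ antidiagonal l,
      (coeff p.1 f * coeff p.2 g) • coeff k (U ^ (p.1 + p.2)) := by
    rw [subNC, coeff_mk]
    refine sum_congr rfl fun l _ => ?_
    rw [coeff_mul, sum_smul]
    refine sum_congr rfl fun p hp => ?_
    rw [HasAntidiagonal.mem_antidiagonal.mp hp]
  -- The triangle n + m ≤ k is compared with the full square: the extra pairs contribute zero
  -- because U^(n+m) starts in degree n + m.
  rw [hL, hR, ← sum_product', sum_sigma']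
  refine sum_bij_ne_zero (fun a _ _ => a.2) ?_ ?_ ?_ ?_
  · rintro ⟨l, p⟩ h _
    simp only [mem_sigma, mem_range, HasAntidiagonal.mem_antidiagonal] at h
    simp only [mem_product, mem_range]
    omega
  · rintro ⟨l, p⟩ h _ ⟨l', p'⟩ h' _ heq
    simp only [mem_sigma, mem_range, HasAntidiagonal.mem_antidiagonal] at h h' heq
    subst heq
    obtain rfl : l = l' := h.2.symm.trans h'.2
    rfl
  · rintro p hp hne
    refine ⟨⟨p.1 + p.2, p⟩, ?_, hne, rfl⟩
    simp only [mem_sigma, mem_range, HasAntidiagonal.mem_antidiagonal, and_true]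
    by_contra hlt
    exact hne (by rw [coeff_pow_eq_zero_of_lt hU (by omega), smul_zero])
  · intros; rfl

/-- Substitution of a series without constant term, as a ring homomorphism. -/
noncomputable def subHom (K : Type*) [CommRing K] [Algebra K A] (U : A⟦X⟧)
    (hU : constantCoeff U = 0) : K⟦X⟧ →+* A⟦X⟧ :=
  RingHom.mk' { toFun := subNC U, map_one' := subNC_one U, map_mul' := subNC_mul hU }
    (subNC_add U)

theorem subNC_X {U : A⟦X⟧} (hU : constantCoeff U = 0) : subNC U (X : K⟦X⟧) = U := by
  ext k
  rw [coeff_subNC hU _ (show k < k + 2 by omega), sum_eq_single 1]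
  · simp
  · intro b _ hb; simp [coeff_X, hb]
  · simp

theorem subNC_smul (U : A⟦X⟧) (a : K) (f : K⟦X⟧) : subNC U (a • f) = a • subNC U f := by
  ext k
  simp [subNC, smul_sum, smul_smul]

theorem constantCoeff_subNC (U : A⟦X⟧) (f : K⟦X⟧) :
    constantCoeff (subNC U f) = algebraMap K A (constantCoeff f) := by
  rw [← coeff_zero_eq_constantCoeff_apply, subNC, coeff_mk]
  simp [Algebra.algebraMap_eq_smul_one]

theorem coeff_C_mul_X_pow_eq (x : A) (k n : ℕ) :
    coeff k ((C x * X : A⟦X⟧) ^ n) = if k = n then x ^ k else 0 := by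
  rw [Commute.mul_pow (commute_X _), ← map_pow, coeff_C_mul, coeff_X_pow]
  split_ifs with h <;> simp [h]

theorem constantCoeff_C_mul_X (x : A) : constantCoeff (C x * X : A⟦X⟧) = 0 := by simp

theorem coeff_subNC_C_mul_X (x : A) (f : K⟦X⟧) (k : ℕ) :
    coeff k (subNC (C x * X) f) = coeff k f • x ^ k := by
  rw [subNC, coeff_mk, sum_eq_single k]
  · rw [coeff_C_mul_X_pow_eq, if_pos rfl]
  · intro b _ hb; rw [coeff_C_mul_X_pow_eq, if_neg hb.symm, smul_zero]
  · simp

end FormalSubstitution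

/-! ### The formal identity exp(log(1 + X)) = 1 + X -/

section ExpLog

/-- With D = 1/(1 + X) the derivative of the logarithm, E' = ED and D' = -D². Hence ED has
derivative zero and constant term 1. -/
theorem exp_subst_log : (PowerSeries.exp ℝ).subst (PowerSeries.log ℝ) = 1 + X := by
  have hl := HasSubst.log (A := ℝ)
  have hgeom : d⁄dX ℝ (PowerSeries.log ℝ) * (1 + X) = 1 := by
    rw [deriv_log]
    ext n
    rw [mul_add, mul_one, map_add]
    rcases n with _ | n
    · simp
    · rw [coeff_succ_mul_X, coeff_mk, coeff_mk]
      simp [coeff_one, pow_succ]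
  set E := (PowerSeries.exp ℝ).subst (PowerSeries.log ℝ) with hE
  have hd : d⁄dX ℝ E = E * d⁄dX ℝ (PowerSeries.log ℝ) := by
    rw [hE, derivative_subst hl, derivative_exp]
  have hc : constantCoeff E = 1 := by
    rw [hE, ← coeff_zero_eq_constantCoeff_apply, coeff_subst' hl, finsum_eq_single _ 0]
    · simp
    · intro n hn; simp [hn]
  set D := d⁄dX ℝ (PowerSeries.log ℝ)
  have hdD : d⁄dX ℝ D = - D * D := by
    have := congrArg (d⁄dX ℝ) hgeom
    simp only [Derivation.leibniz, map_add, derivative_X, derivative_one, smul_eq_mul] at this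
    linear_combination D * this - d⁄dX ℝ D * hgeom
  have hED : E * D = 1 := by
    refine derivative.ext ?_ ?_
    · simp only [Derivation.leibniz, derivative_one, smul_eq_mul, hd, hdD]
      ring
    · have := congrArg constantCoeff hgeom
      simp only [map_mul, map_add, map_one, constantCoeff_X] at this ⊢
      rw [hc]; linarith
  linear_combination (1 + X) * hED - E * hgeom

theorem sum_coeff_log_pow {m N : ℕ} (h : m < N) :
    ∑ n ∈ range N, ((n.factorial : ℝ)⁻¹) * coeff m ((PowerSeries.log ℝ) ^ n) =
      coeff m (1 + X : ℝ⟦X⟧) := by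
  rw [← exp_subst_log, coeff_subst' HasSubst.log, finsum_eq_sum_of_support_subset]
  · refine sum_congr rfl fun n _ => ?_
    simp
  · intro n hn
    simp only [Function.mem_support] at hn
    simp only [coe_range, Set.mem_Iio]
    by_contra hlt
    exact hn (by rw [coeff_pow_eq_zero_of_lt constantCoeff_log (by omega), smul_zero])

end ExpLog

/-! ### From series in words to power series in the length variable -/

section WordSeries

variable {A : Type*} [Ring A] [Algebra ℝ A]

/-- The sum of the words of length `k` of a series `f`, evaluated at `x`. -/
noncomputable def wordSum (x : Fin 2 → A) (f : NCSeries) (k : ℕ) : A :=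
  ∑ w : Fin k → Fin 2, ((f (List.ofFn w) : ℚ) : ℝ) • (List.ofFn fun i => x (w i)).prod

theorem wordSum_zero (x : Fin 2 → A) (f : NCSeries) :
    wordSum x f 0 = ((f [] : ℚ) : ℝ) • (1 : A) := by
  simp [wordSum]

theorem wordSum_succ (x : Fin 2 → A) (f : NCSeries) (k : ℕ) :
    wordSum x f (k + 1) = ∑ a, x a * wordSum x (fun w => f (a :: w)) k := by
  rw [wordSum, ← (Fin.consEquiv fun _ => Fin 2).sum_comp, Fintype.sum_prod_type]
  simp [wordSum, Fin.consEquiv, List.ofFn_succ, mul_sum]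

theorem wordSum_add (x : Fin 2 → A) (f g : NCSeries) (k : ℕ) :
    wordSum x (f + g) k = wordSum x f k + wordSum x g k := by
  simp [wordSum, add_smul, sum_add_distrib]

theorem wordSum_smul (x : Fin 2 → A) (c : ℚ) (f : NCSeries) (k : ℕ) :
    wordSum x (c • f) k = (c : ℝ) • wordSum x f k := by
  simp [wordSum, smul_sum, smul_smul]

theorem NCSeries.mul_cons (f g : NCSeries) (a : Fin 2) :
    (fun w => NCSeries.mul f g (a :: w)) =
      f [] • (fun w => g (a :: w)) + NCSeries.mul (fun w => f (a :: w)) g := by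
  ext w
  simp only [NCSeries.mul, List.length_cons]
  rw [sum_range_succ' _ (w.length + 1), add_comm]
  simp [NCSeries.mul]

/-- Induction on the length, splitting off the first letter: it belongs to the right factor if the
left one is empty, and otherwise to the left factor. -/
theorem wordSum_mul (x : Fin 2 → A) (f g : NCSeries) (k : ℕ) :
    wordSum x (NCSeries.mul f g) k =
      ∑ p ∈ antidiagonal k, wordSum x f p.1 * wordSum x g p.2 := by
  induction k generalizing f with
  | zero => simp [wordSum_zero, NCSeries.mul, smul_smul, mul_comm]
  | succ k ih =>
    rw [Nat.antidiagonal_succ, sum_cons, sum_map, wordSum_succ]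
    simp_rw [NCSeries.mul_cons, wordSum_add, wordSum_smul, ih]
    simp only [mul_add, sum_add_distrib, mul_smul_comm, ← smul_sum, ← wordSum_succ]
    congr 1
    · simp [wordSum_zero]
    · simp only [Function.Embedding.prodMap, Function.Embedding.coeFn_mk, Prod.map,
        Function.Embedding.refl_apply, wordSum_succ, sum_mul, mul_sum]
      rw [sum_comm]
      simp [mul_assoc]

/-- The power series in the length variable obtained by evaluating the words of `f` at `x`. -/
noncomputable def wordSeries (x : Fin 2 → A) (f : NCSeries) : A⟦X⟧ :=
  PowerSeries.mk (wordSum x f)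

theorem coeff_wordSeries (x : Fin 2 → A) (f : NCSeries) (k : ℕ) :
    coeff k (wordSeries x f) = wordSum x f k := coeff_mk _ _

theorem wordSeries_mul (x : Fin 2 → A) (f g : NCSeries) :
    wordSeries x (NCSeries.mul f g) = wordSeries x f * wordSeries x g := by
  ext k
  simp [coeff_mul, coeff_wordSeries, wordSum_mul]

theorem wordSeries_one (x : Fin 2 → A) : wordSeries x NCSeries.one = 1 := by
  ext k
  rw [coeff_wordSeries, coeff_one]
  rcases k with _ | k
  · simp [wordSum_zero, NCSeries.one]
  · simp [wordSum, NCSeries.one]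

theorem wordSeries_sub (x : Fin 2 → A) (f g : NCSeries) :
    wordSeries x (f - g) = wordSeries x f - wordSeries x g := by
  ext k
  simp [coeff_wordSeries, wordSum, sub_smul]

theorem wordSeries_letter (x : Fin 2 → A) (a : Fin 2) :
    wordSeries x (NCSeries.letter a) = C (x a) * X := by
  ext k
  rw [coeff_wordSeries]
  rcases k with _ | k
  · simp [wordSum_zero, NCSeries.letter]
  · rw [wordSum_succ, coeff_succ_mul_X, coeff_C]
    rcases k with _ | k
    · fin_cases a <;> simp [wordSum_zero, NCSeries.letter]
    · simp [wordSum, NCSeries.letter]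

theorem wordSeries_pow (x : Fin 2 → A) (f : NCSeries) (n : ℕ) :
    wordSeries x (NCSeries.pow f n) = wordSeries x f ^ n := by
  induction n with
  | zero => exact wordSeries_one x
  | succ n ih => rw [NCSeries.pow, wordSeries_mul, ih, pow_succ']

theorem wordSum_sum_length (x : Fin 2 → A) (c : ℕ → ℚ) (F : ℕ → NCSeries) (s : ℕ → Finset ℕ)
    (k : ℕ) :
    wordSum x (fun w => ∑ n ∈ s w.length, c n * F n w) k =
      ∑ n ∈ s k, (c n : ℝ) • wordSum x (F n) k := by
  simp only [wordSum, List.length_ofFn, smul_sum]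
  rw [sum_comm]
  simp [sum_smul, smul_smul]

theorem wordSeries_exp_letter (x : Fin 2 → A) (a : Fin 2) :
    wordSeries x (NCSeries.exp (NCSeries.letter a)) =
      subNC (C (x a) * X) (PowerSeries.exp ℝ) := by
  ext k
  rw [coeff_wordSeries, subNC, coeff_mk]
  refine (wordSum_sum_length x _ _ (fun l => range (l + 1)) k).trans ?_
  refine sum_congr rfl fun n _ => ?_
  rw [← coeff_wordSeries, wordSeries_pow, wordSeries_letter]
  simp

theorem wordSeries_log (x : Fin 2 → A) (f : NCSeries) :
    wordSeries x (NCSeries.log f) = subNC (wordSeries x f - 1) (PowerSeries.log ℝ) := by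
  ext k
  rw [coeff_wordSeries, subNC, coeff_mk]
  refine (wordSum_sum_length x _ _ (fun l => Icc 1 l) k).trans ?_
  rw [sum_range_eq_add_Ico _ (by omega)]
  simp only [coeff_log, if_pos, zero_smul, zero_add]
  refine sum_congr (by ext; simp) fun n hn => ?_
  rw [mem_Ico] at hn
  rw [← coeff_wordSeries, wordSeries_pow, wordSeries_sub, wordSeries_one, if_neg (by omega)]
  obtain ⟨m, rfl⟩ : ∃ m, n = m + 1 := ⟨n - 1, by omega⟩
  simp [pow_succ]

/-- The series `exp (X T) exp (Y T) - 1` in the central variable `T`. -/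
noncomputable def expProdSubOne (x y : A) : A⟦X⟧ :=
  subNC (C x * X) (PowerSeries.exp ℝ) * subNC (C y * X) (PowerSeries.exp ℝ) - 1

theorem constantCoeff_expProdSubOne (x y : A) : constantCoeff (expProdSubOne x y) = 0 := by
  simp [expProdSubOne, constantCoeff_subNC]

theorem goldbergTerm_eq_coeff (x y : A) (k : ℕ) :
    goldbergTerm ℝ x y k = coeff k (subNC (expProdSubOne x y) (PowerSeries.log ℝ)) := by
  have h : goldbergTerm ℝ x y k = coeff k (wordSeries ![x, y] goldbergCoeff) := by
    rw [coeff_wordSeries]; rfl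
  rw [h, goldbergCoeff, wordSeries_log, wordSeries_mul, wordSeries_exp_letter,
    wordSeries_exp_letter]
  rfl

end WordSeries

/-! ### Riccati equation of the block series and differential inequalities for its majorants -/

section RealEstimate

/-- The power series `(exp T - 1) / (1 + t (exp T - 1))`. -/
noncomputable def blockSeries (t : ℝ) : ℝ⟦X⟧ :=
  (PowerSeries.exp ℝ - 1) * (1 + t • (PowerSeries.exp ℝ - 1))⁻¹

theorem blockSeries_mul (t : ℝ) :
    blockSeries t * (1 + t • (PowerSeries.exp ℝ - 1)) = PowerSeries.exp ℝ - 1 := by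
  rw [blockSeries, mul_assoc, PowerSeries.inv_mul_cancel _ (by simp), mul_one]

theorem constantCoeff_blockSeries (t : ℝ) : constantCoeff (blockSeries t) = 0 := by
  simp [blockSeries]

/-- A Möbius transform of the exponential satisfies a Riccati equation with constant coefficients.
-/
theorem derivative_blockSeries (t : ℝ) :
    d⁄dX ℝ (blockSeries t) =
      1 + (1 - 2 * t) • blockSeries t - (t * (1 - t)) • blockSeries t ^ 2 := by
  set V : ℝ⟦X⟧ := 1 + t • (PowerSeries.exp ℝ - 1) with hV
  have hVV : V * V⁻¹ = 1 := PowerSeries.mul_inv_cancel _ (by simp [hV])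
  have hdV : d⁄dX ℝ V = t • PowerSeries.exp ℝ := by
    simp [hV, derivative_exp]
  have h2 : C (2 : ℝ) = (2 : ℝ⟦X⟧) := map_ofNat C 2
  rw [blockSeries, ← hV, Derivation.leibniz, derivative_inv', hdV]
  simp only [map_sub, derivative_exp, derivative_one, smul_eq_mul, sub_zero,
    PowerSeries.smul_eq_C_mul, map_mul, map_one, h2] at hV ⊢
  generalize V⁻¹ = I at hVV ⊢
  rw [hV] at hVV
  linear_combination (1 - C t * (PowerSeries.exp ℝ - 1) * I) * hVV

/-- All coefficients of the real power series `f` are nonnegative. -/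
def NonnegCoeff (f : ℝ⟦X⟧) : Prop := ∀ k, 0 ≤ coeff k f

theorem NonnegCoeff.add {f g : ℝ⟦X⟧} (hf : NonnegCoeff f) (hg : NonnegCoeff g) :
    NonnegCoeff (f + g) := fun k => by
  rw [map_add]; exact add_nonneg (hf k) (hg k)

theorem NonnegCoeff.mul {f g : ℝ⟦X⟧} (hf : NonnegCoeff f) (hg : NonnegCoeff g) :
    NonnegCoeff (f * g) := fun k => by
  rw [coeff_mul]; exact sum_nonneg fun p _ => mul_nonneg (hf p.1) (hg p.2)

theorem NonnegCoeff.smul {f : ℝ⟦X⟧} {a : ℝ} (ha : 0 ≤ a) (hf : NonnegCoeff f) :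
    NonnegCoeff (a • f) := fun k => by
  rw [map_smul]; exact mul_nonneg ha (hf k)

theorem NonnegCoeff.one : NonnegCoeff 1 := fun k => by
  rw [coeff_one]; split_ifs <;> norm_num

theorem coeff_mul_eq_sum_of_constantCoeff_eq_zero {A : Type*} [Ring A] {f g : A⟦X⟧}
    (hf : constantCoeff f = 0) (k : ℕ) :
    coeff k (f * g) = ∑ p ∈ antidiagonal k with p.2 < k, coeff p.1 f * coeff p.2 g := by
  rw [coeff_mul]
  refine (sum_filter_of_ne fun p hp hne => ?_).symm
  rw [HasAntidiagonal.mem_antidiagonal] at hp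
  rcases Nat.eq_zero_or_pos p.1 with h0 | h0
  · rw [h0, coeff_zero_eq_constantCoeff_apply, hf, zero_mul] at hne
    exact absurd rfl hne
  · omega

theorem NonnegCoeff.inv_one_sub {f : ℝ⟦X⟧} (hf : NonnegCoeff f) (h0 : constantCoeff f = 0) :
    NonnegCoeff (1 - f)⁻¹ := by
  have hI : (1 - f)⁻¹ = 1 + f * (1 - f)⁻¹ := by
    have := PowerSeries.mul_inv_cancel (1 - f) (by simp [h0])
    linear_combination this
  intro k
  induction k using Nat.strong_induction_on with
  | _ k ih =>
    rw [hI, map_add, coeff_mul_eq_sum_of_constantCoeff_eq_zero h0]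
    refine add_nonneg (NonnegCoeff.one k) (sum_nonneg fun p hp => mul_nonneg (hf _) (ih _ ?_))
    exact (mem_filter.mp hp).2

/-- The series of absolute values of the coefficients of `blockSeries t`. -/
noncomputable def absBlockSeries (t : ℝ) : ℝ⟦X⟧ :=
  PowerSeries.mk fun k => |coeff k (blockSeries t)|

theorem absBlockSeries_nonneg (t : ℝ) : NonnegCoeff (absBlockSeries t) := fun k => by
  rw [absBlockSeries, coeff_mk]; exact abs_nonneg _

theorem constantCoeff_absBlockSeries (t : ℝ) : constantCoeff (absBlockSeries t) = 0 := by
  rw [← coeff_zero_eq_constantCoeff_apply, absBlockSeries, coeff_mk,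
    coeff_zero_eq_constantCoeff_apply, constantCoeff_blockSeries, abs_zero]

/-- Triangle inequality in each coefficient of the Riccati equation; differentiation multiplies
coefficients by positive numbers and so commutes with absolute values. -/
theorem derivative_absBlockSeries_le {t : ℝ} (ht : 0 ≤ t * (1 - t)) :
    NonnegCoeff (1 + |1 - 2 * t| • absBlockSeries t + (t * (1 - t)) • absBlockSeries t ^ 2 -
      d⁄dX ℝ (absBlockSeries t)) := by
  intro k
  have hD := congrArg (coeff k) (derivative_blockSeries t)
  have hle : |coeff k (blockSeries t ^ 2)| ≤ coeff k (absBlockSeries t ^ 2) := by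
    rw [sq, sq, coeff_mul, coeff_mul]
    refine (abs_sum_le_sum_abs _ _).trans (le_of_eq (sum_congr rfl fun p _ => ?_))
    rw [abs_mul, absBlockSeries, coeff_mk, coeff_mk]
  have hc : coeff k (d⁄dX ℝ (absBlockSeries t)) = |coeff k (d⁄dX ℝ (blockSeries t))| := by
    rw [coeff_derivative, coeff_derivative, absBlockSeries, coeff_mk, abs_mul,
      abs_of_nonneg (by positivity : (0 : ℝ) ≤ k + 1)]
  have hk : coeff k (absBlockSeries t) = |coeff k (blockSeries t)| := by
    rw [absBlockSeries, coeff_mk]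
  have h1 : |coeff k (1 : ℝ⟦X⟧)| = coeff k (1 : ℝ⟦X⟧) := abs_of_nonneg (NonnegCoeff.one k)
  rw [map_sub, hc, hD]
  simp only [map_add, map_sub, map_smul, smul_eq_mul, hk]
  rw [sub_nonneg]
  refine (abs_sub _ _).trans ?_
  refine add_le_add ((abs_add_le _ _).trans (le_of_eq ?_)) ?_
  · rw [h1, abs_mul]
  · rw [abs_mul, abs_of_nonneg ht]
    exact mul_le_mul_of_nonneg_left hle ht

theorem derivative_inv_one_sub_smul_sq (c : ℝ⟦X⟧) (q : ℝ) :
    d⁄dX ℝ (1 - q • c ^ 2)⁻¹ = 2 * C q * c * d⁄dX ℝ c * (1 - q • c ^ 2)⁻¹ ^ 2 := by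
  rw [derivative_inv', map_sub, derivative_one, Derivation.map_smul, derivative_pow]
  simp only [PowerSeries.smul_eq_C_mul]
  push_cast
  ring

/-- Chain rule for s = 2c/(1 - qc²), with ds/dc = 2(1 + qc²)I² and 1 + 2qe = (1 + qc²)I. The defect
is an explicit multiple of the residual r, so nonnegativity of r passes to it. -/
theorem majorant_derivative_odd {c r I : ℝ⟦X⟧} {u q : ℝ}
    (hr : r = 1 + u • c + q • c ^ 2 - d⁄dX ℝ c) (hI : (1 - q • c ^ 2)⁻¹ = I)
    (h0 : constantCoeff c = 0) :
    (2 : ℝ) • (1 + (2 * q) • (c ^ 2 * I)) ^ 2 +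
        u • ((2 : ℝ) • (c * I) * (1 + (2 * q) • (c ^ 2 * I))) - d⁄dX ℝ ((2 : ℝ) • (c * I)) =
      (2 : ℝ) • (r * (1 + q • c ^ 2) * I ^ 2) := by
  have hV : (1 - q • c ^ 2) * I = 1 := by
    rw [← hI]; exact PowerSeries.mul_inv_cancel _ (by simp [h0])
  have hdI := derivative_inv_one_sub_smul_sq c q
  rw [hI] at hdI
  rw [Derivation.map_smul, Derivation.leibniz, hdI]
  have h2 : C (2 : ℝ) = (2 : ℝ⟦X⟧) := map_ofNat C 2
  simp only [PowerSeries.smul_eq_C_mul, smul_eq_mul, map_mul, h2] at hV hr ⊢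
  have hW : 1 + 2 * C q * (c ^ 2 * I) = (1 + C q * c ^ 2) * I := by linear_combination -hV
  rw [hW, hr]
  linear_combination (2 * I * d⁄dX ℝ c) * hV

/-- The same for e = c²/(1 - qc²), where de/dc = 2cI². -/
theorem majorant_derivative_even {c r I : ℝ⟦X⟧} {u q : ℝ}
    (hr : r = 1 + u • c + q • c ^ 2 - d⁄dX ℝ c) (hI : (1 - q • c ^ 2)⁻¹ = I)
    (h0 : constantCoeff c = 0) :
    (2 : ℝ) • (c * I) * (1 + (2 * q) • (c ^ 2 * I)) + (u / 2) • ((2 : ℝ) • (c * I)) ^ 2 -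
        d⁄dX ℝ (c ^ 2 * I) =
      (2 : ℝ) • (r * c * I ^ 2) := by
  have hV : (1 - q • c ^ 2) * I = 1 := by
    rw [← hI]; exact PowerSeries.mul_inv_cancel _ (by simp [h0])
  have hdI := derivative_inv_one_sub_smul_sq c q
  rw [hI] at hdI
  rw [Derivation.leibniz, hdI, derivative_pow]
  have h2 : C (2 : ℝ) = (2 : ℝ⟦X⟧) := map_ofNat C 2
  have hu : C u = 2 * C (u / 2) := by rw [← h2, ← map_mul]; congr 1; ring
  simp only [PowerSeries.smul_eq_C_mul, smul_eq_mul, map_mul, h2] at hV hr ⊢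
  have hW : 1 + 2 * C q * (c ^ 2 * I) = (1 + C q * c ^ 2) * I := by linear_combination -hV
  rw [hW, hr, hu]
  push_cast
  linear_combination (2 * c * I * d⁄dX ℝ c) * hV

end RealEstimate

/-! ### Coefficient bounds from the recursive inequalities -/

section Recursion

/-- The m middle products are at most 1 each. The three at either end involve p 1, p 2, p 3 and give
2(2 + 2 + 4/3) = 32/3. -/
theorem sum_antidiagonal_le_of_le_one {p : ℕ → ℝ} (hp : ∀ k, 0 ≤ p k) (p0 : p 0 = 0)
    (p1 : p 1 ≤ 2) (p2 : p 2 ≤ 2) (p3 : p 3 ≤ 4 / 3) (m : ℕ)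
    (h : ∀ k, 4 ≤ k → k < m + 8 → p k ≤ 1) :
    ∑ x ∈ antidiagonal (m + 7), p x.1 * p x.2 ≤ m + 32 / 3 := by
  have hmul : ∀ {a b A B : ℝ}, 0 ≤ b → 0 ≤ A → a ≤ A → b ≤ B → a * b ≤ A * B :=
    fun hb hA ha hbB => mul_le_mul ha hbB hb hA
  rw [Nat.sum_antidiagonal_eq_sum_range_succ (fun i j => p i * p j), Nat.succ_eq_add_one,
    sum_range_succ, sum_range_succ, sum_range_succ, sum_range_succ, sum_range_succ', sum_range_succ',
    sum_range_succ', sum_range_succ']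
  have hmid : ∑ k ∈ range m, p (k + 1 + 1 + 1 + 1) * p (m + 7 - (k + 1 + 1 + 1 + 1)) ≤ m := by
    refine (sum_le_card_nsmul _ _ 1 fun k hk => ?_).trans (by simp)
    have := mem_range.mp hk
    calc _ ≤ (1 : ℝ) * 1 := hmul (hp _) zero_le_one (h _ (by omega) (by omega))
            (h _ (by omega) (by omega))
      _ = 1 := one_mul 1
  have e1 : m + 7 - (m + 4) = 3 := by omega
  have e2 : m + 7 - (m + 4 + 1) = 2 := by omega
  have e3 : m + 7 - (m + 4 + 2) = 1 := by omega
  have e4 : m + 7 - (m + 4 + 3) = 0 := by omega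
  have f1 : m + 7 - (0 + 1) = m + 6 := by omega
  have f2 : m + 7 - (0 + 1 + 1) = m + 5 := by omega
  have f3 : m + 7 - (0 + 1 + 1 + 1) = m + 4 := by omega
  simp only [e1, e2, e3, e4, f1, f2, f3, p0, mul_zero, zero_mul, add_zero]
  have h4 := h (m + 4) (by omega) (by omega)
  have h5 := h (m + 5) (by omega) (by omega)
  have h6 := h (m + 6) (by omega) (by omega)
  have a1 := hmul (hp (m + 6)) zero_le_two p1 h6
  have a2 := hmul (hp (m + 5)) zero_le_two p2 h5
  have a3 := hmul (hp (m + 4)) (by norm_num) p3 h4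
  have b1 := hmul (hp 1) zero_le_one h6 p1
  have b2 := hmul (hp 2) zero_le_one h5 p2
  have b3 := hmul (hp 3) zero_le_one h4 p3
  norm_num at *
  linarith

/-- The induction closes from degree 8 on because 2 + (m + 32/3)/2 ≤ m + 8; degrees 6 and 7 are
computed directly. -/
theorem le_one_of_riccati {p : ℕ → ℝ} (hp : ∀ k, 0 ≤ p k) (p0 : p 0 = 0)
    (p1 : p 1 ≤ 2) (p2 : p 2 ≤ 2) (p3 : p 3 ≤ 4 / 3) (p4 : p 4 ≤ 6 / 7) (p5 : p 5 ≤ 2 / 3)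
    (h : ∀ k : ℕ, 1 ≤ k →
      (k + 1) * p (k + 1) ≤ 2 * p k + 1 / 2 * ∑ x ∈ antidiagonal k, p x.1 * p x.2) :
    ∀ k, 4 ≤ k → p k ≤ 1 := by
  have hmul : ∀ {a b A B : ℝ}, 0 ≤ b → 0 ≤ A → a ≤ A → b ≤ B → a * b ≤ A * B :=
    fun hb hA ha hbB => mul_le_mul ha hbB hb hA
  have p6 : p 6 ≤ 1 := by
    have := h 5 (by norm_num)
    simp [Nat.antidiagonal_succ, p0] at this
    have := hmul (hp 4) zero_le_two p1 p4
    have := hmul (hp 3) zero_le_two p2 p3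
    linarith
  have p7 : p 7 ≤ 1 := by
    have := h 6 (by norm_num)
    simp [Nat.antidiagonal_succ, p0] at this
    have := hmul (hp 5) zero_le_two p1 p5
    have := hmul (hp 4) zero_le_two p2 p4
    have := hmul (hp 3) (by norm_num) p3 p3
    linarith
  intro k
  induction k using Nat.strong_induction_on with
  | _ k ih =>
    intro hk
    rcases lt_or_ge k 8 with hk8 | hk8
    · interval_cases k <;> linarith
    · obtain ⟨m, rfl⟩ : ∃ m, k = m + 8 := ⟨k - 8, by omega⟩
      have h1 := h (m + 7) (by omega)
      have h2 := sum_antidiagonal_le_of_le_one hp p0 p1 p2 p3 m fun k h4 hkm => ih k hkm h4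
      have h3 := ih (m + 7) (by omega) (by omega)
      push_cast at h1
      rw [show m + 7 + 1 = m + 8 from rfl] at h1
      have hm : (0 : ℝ) ≤ m := m.cast_nonneg
      have h4 : ((m : ℝ) + 7 + 1) * p (m + 8) ≤ (m + 7 + 1) * 1 := by linarith
      exact le_of_mul_le_mul_left h4 (by linarith)

theorem riccati_of_recursion {s e : ℕ → ℝ} {u q : ℝ} (hu0 : 0 ≤ u) (hu1 : u ≤ 1)
    (hq : 4 * q = 1 - u ^ 2) (hs : ∀ k, 0 ≤ s k) (he : ∀ k, 0 ≤ e k)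
    (hs' : ∀ k : ℕ, (k + 1) * s (k + 1) ≤ (if k = 0 then 2 else 0) + 8 * q * e k +
      8 * q ^ 2 * ∑ x ∈ antidiagonal k, e x.1 * e x.2 + u * s k +
      2 * u * q * ∑ x ∈ antidiagonal k, s x.1 * e x.2)
    (he' : ∀ k : ℕ, (k + 1) * e (k + 1) ≤ s k + 2 * q * ∑ x ∈ antidiagonal k, s x.1 * e x.2 +
      u / 2 * ∑ x ∈ antidiagonal k, s x.1 * s x.2) (k : ℕ) (hk : 1 ≤ k) :
    (k + 1) * (s (k + 1) + e (k + 1)) ≤ 2 * (s k + e k) +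
      1 / 2 * ∑ x ∈ antidiagonal k, (s x.1 + e x.1) * (s x.2 + e x.2) := by
  have hu2 : u ^ 2 ≤ 1 := by nlinarith
  have c1 : 8 * q ≤ 2 := by linarith [sq_nonneg u]
  have c2 : 8 * q ^ 2 ≤ 1 / 2 := by nlinarith
  have c3 : 2 * u * q + 2 * q ≤ 1 := by
    obtain rfl : q = (1 - u ^ 2) / 4 := by linarith
    nlinarith [sq_nonneg (u - 1 / 3)]
  have h1 := hs' k
  have h2 := he' k
  rw [if_neg (by omega)] at h1
  have hcomm : ∑ x ∈ antidiagonal k, e x.1 * s x.2 = ∑ x ∈ antidiagonal k, s x.1 * e x.2 := by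
    rw [← Nat.sum_antidiagonal_swap]
    exact sum_congr rfl fun x _ => mul_comm _ _
  have hsum : ∑ x ∈ antidiagonal k, (s x.1 + e x.1) * (s x.2 + e x.2) =
      ∑ x ∈ antidiagonal k, s x.1 * s x.2 + 2 * ∑ x ∈ antidiagonal k, s x.1 * e x.2 +
        ∑ x ∈ antidiagonal k, e x.1 * e x.2 := by
    simp only [add_mul, mul_add, sum_add_distrib, hcomm]
    ring
  rw [hsum]
  have nss : 0 ≤ ∑ x ∈ antidiagonal k, s x.1 * s x.2 :=
    sum_nonneg fun x _ => mul_nonneg (hs _) (hs _)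
  have nse : 0 ≤ ∑ x ∈ antidiagonal k, s x.1 * e x.2 :=
    sum_nonneg fun x _ => mul_nonneg (hs _) (he _)
  have nee : 0 ≤ ∑ x ∈ antidiagonal k, e x.1 * e x.2 :=
    sum_nonneg fun x _ => mul_nonneg (he _) (he _)
  have d1 := mul_le_mul_of_nonneg_right c1 (he k)
  have d2 := mul_le_mul_of_nonneg_right c2 nee
  have d3 := mul_le_mul_of_nonneg_right c3 nse
  have d4 := mul_le_mul_of_nonneg_right hu1 (hs k)
  have d5 := mul_le_mul_of_nonneg_right hu1 nss
  linarith [hs k]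

/-- The recursion for p alone is too lossy at the start: the bounds on p 1, p 2, p 3 would only give
p 4 ≤ 11/6. Degrees up to 5 are therefore estimated from the coupled system, as polynomials in u via
q = (1 - u²)/4. -/
theorem add_le_one_of_recursion {s e : ℕ → ℝ} {u q : ℝ} (hu0 : 0 ≤ u) (hu1 : u ≤ 1)
    (hq : 4 * q = 1 - u ^ 2) (s0 : s 0 = 0) (e0 : e 0 = 0) (hs : ∀ k, 0 ≤ s k)
    (he : ∀ k, 0 ≤ e k)
    (hs' : ∀ k : ℕ, (k + 1) * s (k + 1) ≤ (if k = 0 then 2 else 0) + 8 * q * e k +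
      8 * q ^ 2 * ∑ x ∈ antidiagonal k, e x.1 * e x.2 + u * s k +
      2 * u * q * ∑ x ∈ antidiagonal k, s x.1 * e x.2)
    (he' : ∀ k : ℕ, (k + 1) * e (k + 1) ≤ s k + 2 * q * ∑ x ∈ antidiagonal k, s x.1 * e x.2 +
      u / 2 * ∑ x ∈ antidiagonal k, s x.1 * s x.2) :
    ∀ k, 4 ≤ k → s k + e k ≤ 1 := by
  have hmul : ∀ {a b A B : ℝ}, 0 ≤ b → 0 ≤ A → a ≤ A → b ≤ B → a * b ≤ A * B :=
    fun hb hA ha hbB => mul_le_mul ha hbB hb hA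
  have hu2 : u ^ 2 ≤ 1 := by nlinarith
  have hqdef : q = (1 - u ^ 2) / 4 := by linarith
  have hq0 : 0 ≤ q := by linarith
  have huq : 0 ≤ u * q := mul_nonneg hu0 hq0
  have s1 : s 1 ≤ 2 := by simpa [s0, e0] using hs' 0
  have e1 : e 1 = 0 := le_antisymm (by simpa [s0, e0] using he' 0) (he 1)
  have s2 : s 2 ≤ u := by
    have := hs' 1
    simp [Nat.antidiagonal_succ, s0, e0, e1] at this
    nlinarith
  have e2 : e 2 ≤ 1 := by
    have := he' 1
    simp [Nat.antidiagonal_succ, s0, e0, e1] at this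
    linarith
  have s3 : s 3 ≤ (2 - u ^ 2) / 3 := by
    have := hs' 2
    simp [Nat.antidiagonal_succ, s0, e0, e1] at this
    nlinarith
  have e3 : e 3 ≤ u := by
    have := he' 2
    simp [Nat.antidiagonal_succ, s0, e0, e1] at this
    have h11 := hmul (hs 1) zero_le_two s1 s1
    nlinarith
  have s1e2 := hmul (he 2) zero_le_two s1 e2
  have s1e3 := hmul (he 3) zero_le_two s1 e3
  have s1s2 := hmul (hs 2) zero_le_two s1 s2
  have s1s3 := hmul (hs 3) zero_le_two s1 s3
  have s2s2 := hmul (hs 2) hu0 s2 s2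
  have s2e2 := hmul (he 2) hu0 s2 e2
  have e2e2 := hmul (he 2) zero_le_one e2 e2
  have s4 : s 4 ≤ u * (11 - 10 * u ^ 2) / 12 := by
    have := hs' 3
    simp [Nat.antidiagonal_succ, s0, e0, e1] at this
    have h1 := mul_le_mul_of_nonneg_left e3 hq0
    have h2 := mul_le_mul_of_nonneg_left s3 hu0
    have h3 := mul_le_mul_of_nonneg_left s1e2 huq
    rw [hqdef] at *
    linarith
  have e4 : e 4 ≤ (5 + 2 * u ^ 2) / 12 := by
    have := he' 3
    simp [Nat.antidiagonal_succ, s0, e0, e1] at this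
    have h1 := mul_le_mul_of_nonneg_left s1e2 hq0
    have h2 := mul_le_mul_of_nonneg_left s1s2 hu0
    rw [hqdef] at *
    linarith
  have s5 : s 5 ≤ 4 / 15 + 11 / 60 * u ^ 2 - 13 / 30 * u ^ 4 := by
    have := hs' 4
    simp [Nat.antidiagonal_succ, s0, e0, e1] at this
    have h1 := mul_le_mul_of_nonneg_left e4 hq0
    have h2 := mul_le_mul_of_nonneg_left e2e2 (sq_nonneg q)
    have h3 := mul_le_mul_of_nonneg_left s4 hu0
    have h4 := mul_le_mul_of_nonneg_left s2e2 huq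
    have h5 := mul_le_mul_of_nonneg_left s1e3 huq
    rw [hqdef] at *
    linarith
  have e5 : e 5 ≤ 3 / 4 * u - 1 / 2 * u ^ 3 := by
    have := he' 4
    simp [Nat.antidiagonal_succ, s0, e0, e1] at this
    have h1 := mul_le_mul_of_nonneg_left s2e2 hq0
    have h2 := mul_le_mul_of_nonneg_left s1e3 hq0
    have h3 := mul_le_mul_of_nonneg_left s1s3 hu0
    have h4 := mul_le_mul_of_nonneg_left s2s2 hu0
    rw [hqdef] at *
    linarith
  refine le_one_of_riccati (p := fun k => s k + e k) (fun k => add_nonneg (hs k) (he k))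
    (by simp [s0, e0]) (by simp [e1, s1]) (by linarith) (by nlinarith [sq_nonneg (u - 1)]) ?_ ?_
    (riccati_of_recursion hu0 hu1 hq hs he hs' he')
  -- The polynomial bound for p 4 peaks near u = 2/3, just below 6/7, hence squares centred there.
  · nlinarith [sq_nonneg (u - 2 / 3), mul_nonneg hu0 (sq_nonneg (u - 2 / 3))]
  · nlinarith [sq_nonneg (u - 2 / 3), mul_nonneg hu0 (sq_nonneg (u - 2 / 3)),
      sq_nonneg (u ^ 2 - 4 / 9)]

end Recursion

/-! ### Majorants of series with coefficients in A -/

section Majorant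

theorem coeff_algebra_smul {K A : Type*} [CommRing K] [Ring A] [Algebra K A] (a : K) (R : A⟦X⟧)
    (k : ℕ) : coeff k (a • R) = a • coeff k R := rfl

/-- The series `c / (1 - t (1 - t) c²)` for `c = absBlockSeries t`. -/
noncomputable def resolventMajorant (t : ℝ) : ℝ⟦X⟧ :=
  absBlockSeries t * (1 - (t * (1 - t)) • absBlockSeries t ^ 2)⁻¹

theorem resolventMajorant_eq (t : ℝ) :
    resolventMajorant t = absBlockSeries t +
      (t * (1 - t)) • (absBlockSeries t * absBlockSeries t * resolventMajorant t) := by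
  have h : (1 - (t * (1 - t)) • absBlockSeries t ^ 2) *
      (1 - (t * (1 - t)) • absBlockSeries t ^ 2)⁻¹ = 1 :=
    PowerSeries.mul_inv_cancel _ (by simp [constantCoeff_absBlockSeries])
  rw [resolventMajorant]
  simp only [PowerSeries.smul_eq_C_mul] at h ⊢
  linear_combination absBlockSeries t * h

theorem coeff_majorant_le_one {t : ℝ} (ht0 : 0 ≤ t) (ht1 : t ≤ 1) {k : ℕ} (hk : 4 ≤ k) :
    2 * coeff k (resolventMajorant t) + coeff k (absBlockSeries t * resolventMajorant t) ≤ 1 := by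
  have hq : 0 ≤ t * (1 - t) := mul_nonneg ht0 (sub_nonneg.mpr ht1)
  have hc := absBlockSeries_nonneg t
  have h0 := constantCoeff_absBlockSeries t
  have hr := derivative_absBlockSeries_le hq
  have hu : 4 * (t * (1 - t)) = 1 - |1 - 2 * t| ^ 2 := by rw [sq_abs]; ring
  have hu1 : |1 - 2 * t| ≤ 1 := abs_le.mpr ⟨by linarith, by linarith⟩
  rw [resolventMajorant, ← mul_assoc, ← sq]
  set c := absBlockSeries t
  set q := t * (1 - t)
  set u := |1 - 2 * t|
  have hIn : NonnegCoeff (1 - q • c ^ 2)⁻¹ := by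
    refine NonnegCoeff.inv_one_sub (NonnegCoeff.smul hq ?_) (by simp [h0])
    rw [sq]; exact hc.mul hc
  generalize hI : (1 - q • c ^ 2)⁻¹ = I at hIn ⊢
  have hodd := majorant_derivative_odd rfl hI h0 (u := u)
  have heven := majorant_derivative_even rfl hI h0 (u := u)
  set r := 1 + u • c + q • c ^ 2 - d⁄dX ℝ c
  have hsn : NonnegCoeff ((2 : ℝ) • (c * I)) := (hc.mul hIn).smul zero_le_two
  have hen : NonnegCoeff (c ^ 2 * I) := by rw [sq]; exact (hc.mul hc).mul hIn
  have hoddn : NonnegCoeff ((2 : ℝ) • (r * (1 + q • c ^ 2) * I ^ 2)) := by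
    rw [sq, sq]
    exact ((hr.mul (NonnegCoeff.one.add ((hc.mul hc).smul hq))).mul (hIn.mul hIn)).smul zero_le_two
  have hevenn : NonnegCoeff ((2 : ℝ) • (r * c * I ^ 2)) := by
    rw [sq I]
    exact ((hr.mul hc).mul (hIn.mul hIn)).smul zero_le_two
  rw [← hodd] at hoddn
  rw [← heven] at hevenn
  have hs0 : constantCoeff ((2 : ℝ) • (c * I)) = 0 := by simp [h0]
  have he0 : constantCoeff (c ^ 2 * I) = 0 := by simp [h0]
  have hfin : coeff k ((2 : ℝ) • (c * I)) = 2 * coeff k (c * I) := by simp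
  rw [← hfin]
  generalize (2 : ℝ) • (c * I) = s at *
  generalize c ^ 2 * I = e at *
  refine add_le_one_of_recursion (s := fun k => coeff k s) (e := fun k => coeff k e)
    (abs_nonneg (1 - 2 * t)) hu1 hu (by simpa using hs0) (by simpa using he0) hsn hen ?_ ?_ k hk
  · intro k
    have h1 : (2 : ℝ) • (1 + (2 * q) • e) ^ 2 + u • (s * (1 + (2 * q) • e)) =
        (2 : ℝ) • 1 + (8 * q) • e + (8 * q ^ 2) • (e * e) + u • s + (2 * u * q) • (s * e) := by
      have h2 : C (2 : ℝ) = (2 : ℝ⟦X⟧) := map_ofNat C 2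
      have h8 : C (8 : ℝ) = (8 : ℝ⟦X⟧) := map_ofNat C 8
      simp only [PowerSeries.smul_eq_C_mul, map_mul, map_pow, h2, h8]
      ring
    have h3 := hoddn k
    rw [h1, map_sub, coeff_derivative] at h3
    simp only [map_add, map_smul, coeff_one, coeff_mul, smul_eq_mul] at h3
    simp only [mul_ite, mul_one, mul_zero] at h3
    linarith
  · intro k
    have h1 : s * (1 + (2 * q) • e) + (u / 2) • s ^ 2 =
        s + (2 * q) • (s * e) + (u / 2) • (s * s) := by
      simp only [PowerSeries.smul_eq_C_mul]
      ring
    have h3 := hevenn k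
    rw [h1, map_sub, coeff_derivative] at h3
    simp only [map_add, map_smul, coeff_mul, smul_eq_mul] at h3
    linarith

variable {A : Type*} [NormedRing A]

/-- The norms of the coefficients of `R` are bounded by those of `f (μ T)`. -/
def IsMajorant (μ : ℝ) (R : A⟦X⟧) (f : ℝ⟦X⟧) : Prop :=
  ∀ k, ‖coeff k R‖ ≤ μ ^ k * coeff k f

theorem IsMajorant.mul {μ : ℝ} {R S : A⟦X⟧} {f g : ℝ⟦X⟧} (hR : IsMajorant μ R f)
    (hS : IsMajorant μ S g) : IsMajorant μ (R * S) (f * g) := fun k => by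
  rw [coeff_mul, coeff_mul, mul_sum]
  refine norm_sum_le_of_le _ fun p hp => ?_
  rw [← HasAntidiagonal.mem_antidiagonal.mp hp, pow_add]
  calc ‖coeff p.1 R * coeff p.2 S‖ ≤ ‖coeff p.1 R‖ * ‖coeff p.2 S‖ := norm_mul_le _ _
    _ ≤ (μ ^ p.1 * coeff p.1 f) * (μ ^ p.2 * coeff p.2 g) :=
      mul_le_mul (hR _) (hS _) (norm_nonneg _) ((norm_nonneg _).trans (hR _))
    _ = _ := by ring

variable [NormedAlgebra ℝ A]

/-- As P and g have no constant term, both fixed-point equations determine each coefficient from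
lower ones, and strong induction compares them. -/
theorem IsMajorant.of_eq_add_smul_mul {μ a b : ℝ} {R S P : A⟦X⟧} {f g h : ℝ⟦X⟧}
    (hab : |a| ≤ b) (hP0 : constantCoeff P = 0) (hg0 : constantCoeff g = 0)
    (hS : IsMajorant μ S f) (hP : IsMajorant μ P g) (hR : R = S + a • (P * R))
    (hh : h = f + b • (g * h)) : IsMajorant μ R h := by
  intro k
  induction k using Nat.strong_induction_on with
  | _ k ih =>
    rw [hR, hh, map_add, map_add, coeff_algebra_smul, map_smul,
      coeff_mul_eq_sum_of_constantCoeff_eq_zero hP0, coeff_mul_eq_sum_of_constantCoeff_eq_zero hg0,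
      mul_add]
    refine (norm_add_le _ _).trans (add_le_add (hS k) ?_)
    rw [norm_smul, smul_eq_mul, mul_left_comm, Real.norm_eq_abs]
    refine mul_le_mul hab ?_ (norm_nonneg _) ((abs_nonneg _).trans hab)
    rw [mul_sum]
    refine norm_sum_le_of_le _ fun p hp => ?_
    rw [mem_filter, HasAntidiagonal.mem_antidiagonal] at hp
    rw [← hp.1, pow_add]
    calc ‖coeff p.1 P * coeff p.2 R‖ ≤ ‖coeff p.1 P‖ * ‖coeff p.2 R‖ := norm_mul_le _ _
      _ ≤ (μ ^ p.1 * coeff p.1 g) * (μ ^ p.2 * coeff p.2 h) :=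
        mul_le_mul (hP _) (ih _ hp.2) (norm_nonneg _) ((norm_nonneg _).trans (hP _))
      _ = _ := by ring

theorem isMajorant_subNC_blockSeries {μ : ℝ} {x : A} (hx : ‖x‖ ≤ μ) (t : ℝ) :
    IsMajorant μ (subNC (C x * X) (blockSeries t)) (absBlockSeries t) := by
  intro k
  rw [coeff_subNC_C_mul_X, absBlockSeries, coeff_mk, norm_smul, Real.norm_eq_abs, mul_comm]
  -- The bound ‖x^k‖ ≤ μ^k may fail for k = 0, since ‖1‖ is arbitrary; there the block series
  -- vanishes.
  rcases Nat.eq_zero_or_pos k with rfl | hk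
  · simp [constantCoeff_blockSeries]
  · exact mul_le_mul_of_nonneg_right
      ((norm_pow_le' x hk).trans (pow_le_pow_left₀ (norm_nonneg _) hx k)) (abs_nonneg _)

end Majorant

/-! ### Resolvent factorization and the integral over t -/

section Resolvent

/-- The factorization (1 + tx)(1 + t(1 - t)ab)(1 + ty) of the left factor has right inverse F = (1 -
tb)K(1 - ta). The bracket is (1 - F)/t, written without the division by means of 1 - K = t(1 -
t)abK. -/
theorem resolvent_identity {R : Type*} [Ring R] [Algebra ℝ R] {t : ℝ} (ht : t ≠ 0)
    {a b x y K : R} (hxa : (1 + t • x) * a = x) (hyb : (1 + t • y) * b = y)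
    (hby : b * (1 + t • y) = y) (hK : (1 + (t * (1 - t)) • (a * b)) * K = 1) :
    (1 + t • (x + y + x * y)) *
        ((1 - t) • (a * (b * K)) + b * K + K * a - t • (b * (K * a))) = x + y + x * y := by
  have hV : 1 + t • (x + y + x * y) =
      (1 + t • x) * (1 + (t * (1 - t)) • (a * b)) * (1 + t • y) := by
    have h : (1 + t • x) * (1 + (t * (1 - t)) • (a * b)) * (1 + t • y) =
        (1 + t • x) * (1 + t • y) +
          (t * (1 - t)) • (((1 + t • x) * a) * (b * (1 + t • y))) := by
      simp only [mul_add, add_mul, mul_one, one_mul, mul_smul_comm, smul_mul_assoc, smul_add,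
        mul_assoc]
      module
    rw [h, hxa, hby]
    simp only [mul_add, add_mul, mul_one, one_mul, mul_smul_comm, smul_mul_assoc]
    module
  have hy1 : (1 + t • y) * (1 - t • b) = 1 := by
    rw [mul_sub, mul_one, mul_smul_comm, hyb]; abel
  have hx1 : (1 + t • x) * (1 - t • a) = 1 := by
    rw [mul_sub, mul_one, mul_smul_comm, hxa]; abel
  have hK' : K = 1 - (t * (1 - t)) • (a * (b * K)) := by
    rw [add_mul, one_mul, smul_mul_assoc, mul_assoc] at hK
    exact eq_sub_of_add_eq hK
  have hG : t • ((1 - t) • (a * (b * K)) + b * K + K * a - t • (b * (K * a))) =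
      1 - (1 - t • b) * K * (1 - t • a) := by
    have h : (1 - t • b) * K * (1 - t • a) =
        K - t • (b * K) - t • (K * a) + (t * t) • (b * (K * a)) := by
      simp only [sub_mul, mul_sub, mul_one, one_mul, mul_smul_comm, smul_mul_assoc, mul_assoc]
      module
    have h1 : 1 = K + (t * (1 - t)) • (a * (b * K)) := by
      nth_rewrite 1 [hK']; abel
    rw [h]
    conv_rhs => enter [1]; rw [h1]
    module
  have hF : (1 + t • (x + y + x * y)) * ((1 - t • b) * K * (1 - t • a)) = 1 := by
    rw [hV]
    calc _ = (1 + t • x) * ((1 + (t * (1 - t)) • (a * b)) *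
            (((1 + t • y) * (1 - t • b)) * K)) * (1 - t • a) := by simp only [mul_assoc]
      _ = 1 := by rw [hy1, one_mul, hK, mul_one, hx1]
  refine smul_right_injective R ht ?_
  simp only
  rw [← mul_smul_comm, hG, mul_sub, hF, mul_one]
  abel

/-- The power series `T / (1 + t T)`. -/
noncomputable def geomSeries (t : ℝ) : ℝ⟦X⟧ :=
  PowerSeries.mk fun n => if n = 0 then 0 else (-t) ^ (n - 1)

theorem one_add_mul_geomSeries (t : ℝ) : (1 + t • X) * geomSeries t = X := by
  ext n
  rw [add_mul, one_mul, smul_mul_assoc, map_add, map_smul]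
  rcases n with _ | _ | n
  · simp [geomSeries]
  · simp [geomSeries, coeff_succ_X_mul]
  · rw [coeff_succ_X_mul]
    simp [geomSeries, coeff_X, pow_succ, mul_comm t]

theorem integral_coeff_geomSeries (n : ℕ) :
    ∫ t in (0 : ℝ)..1, coeff n (geomSeries t) = coeff n (PowerSeries.log ℝ) := by
  rcases n with _ | n
  · simp [geomSeries]
  · simp only [geomSeries, coeff_mk, Nat.succ_ne_zero, if_false, Nat.add_sub_cancel, coeff_log]
    rw [show (fun t : ℝ => (-t) ^ n) = fun t => (-1) ^ n * t ^ n from funext fun t => neg_pow t n]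
    simp [pow_succ, div_eq_mul_inv]

theorem continuous_coeff_geomSeries (n : ℕ) : Continuous fun t => coeff n (geomSeries t) := by
  rcases n with _ | n
  · simpa [geomSeries] using continuous_const
  · simp only [geomSeries, coeff_mk, Nat.succ_ne_zero, if_false]
    fun_prop

variable {A : Type*} [NormedRing A] [NormedAlgebra ℝ A]

/-- L = bK and M = Ka, with K the inverse of 1 + t(1 - t)ab; expanding K once gives fixed-point
equations suited to `IsMajorant.of_eq_add_smul_mul`. -/
theorem subNC_geomSeries_eq (x y : A) {t : ℝ} (ht : t ≠ 0) :
    ∃ L M : A⟦X⟧,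
      L = subNC (C y * X) (blockSeries t) + (-(t * (1 - t))) •
        (subNC (C y * X) (blockSeries t) * subNC (C x * X) (blockSeries t) * L) ∧
      M = subNC (C x * X) (blockSeries t) + (-(t * (1 - t))) •
        (subNC (C x * X) (blockSeries t) * subNC (C y * X) (blockSeries t) * M) ∧
      subNC (expProdSubOne x y) (geomSeries t) =
        (1 - t) • (subNC (C x * X) (blockSeries t) * L) + L + M -
          t • (subNC (C y * X) (blockSeries t) * M) := by
  have hE : ∀ z : A,
      (1 + t • subNC (C z * X) (PowerSeries.exp ℝ - 1)) * subNC (C z * X) (blockSeries t) =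
        subNC (C z * X) (PowerSeries.exp ℝ - 1) ∧
      subNC (C z * X) (blockSeries t) * (1 + t • subNC (C z * X) (PowerSeries.exp ℝ - 1)) =
        subNC (C z * X) (PowerSeries.exp ℝ - 1) := by
    intro z
    have h := blockSeries_mul t
    have hz := constantCoeff_C_mul_X z
    constructor
    · rw [mul_comm] at h
      rw [← subNC_smul, ← subNC_one (K := ℝ) (C z * X : A⟦X⟧), ← subNC_add, ← subNC_mul hz, h]
    · rw [← subNC_smul, ← subNC_one (K := ℝ) (C z * X : A⟦X⟧), ← subNC_add, ← subNC_mul hz, h]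
  have hexp : ∀ z : A, subNC (C z * X) (PowerSeries.exp ℝ) =
      subNC (C z * X) (PowerSeries.exp ℝ - 1) + 1 := by
    intro z
    rw [← subNC_one (K := ℝ) (C z * X : A⟦X⟧), ← subNC_add, sub_add_cancel]
  have hU : expProdSubOne x y = subNC (C x * X) (PowerSeries.exp ℝ - 1) +
      subNC (C y * X) (PowerSeries.exp ℝ - 1) +
      subNC (C x * X) (PowerSeries.exp ℝ - 1) * subNC (C y * X) (PowerSeries.exp ℝ - 1) := by
    rw [expProdSubOne, hexp x, hexp y]
    noncomm_ring
  have hU0 := constantCoeff_expProdSubOne x y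
  have hab0 : constantCoeff
      (subNC (C x * X) (blockSeries t) * subNC (C y * X) (blockSeries t)) = 0 := by
    simp [constantCoeff_subNC, constantCoeff_blockSeries]
  have hxE := hE x
  have hyE := hE y
  set a := subNC (C x * X) (blockSeries t)
  set b := subNC (C y * X) (blockSeries t)
  set U := expProdSubOne x y
  set q := t * (1 - t)
  have hinv : (1 + q • X : ℝ⟦X⟧) * (1 + q • X)⁻¹ = 1 :=
    PowerSeries.mul_inv_cancel _ (by simp)
  obtain ⟨K, hK⟩ : ∃ K, K = subNC (a * b) (1 + q • X : ℝ⟦X⟧)⁻¹ := ⟨_, rfl⟩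
  have hKl : (1 + q • (a * b)) * K = 1 := by
    rw [hK]
    nth_rewrite 1 [← subNC_X (K := ℝ) hab0]
    rw [← subNC_smul, ← subNC_one (K := ℝ) (a * b), ← subNC_add, ← subNC_mul hab0, hinv]
  have hK' : K = 1 - q • (a * (b * K)) := by
    rw [add_mul, one_mul, smul_mul_assoc, mul_assoc] at hKl
    exact eq_sub_of_add_eq hKl
  refine ⟨b * K, K * a, ?_, ?_, ?_⟩
  · nth_rewrite 1 [hK']
    rw [mul_sub, mul_one, mul_smul_comm, neg_smul, sub_eq_add_neg, mul_assoc]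
  · nth_rewrite 1 [hK']
    rw [sub_mul, one_mul, smul_mul_assoc, neg_smul, sub_eq_add_neg]
    simp only [mul_assoc]
  · have h1 := resolvent_identity ht hxE.1 hyE.1 hyE.2 hKl
    rw [← hU] at h1
    have hinvt : (1 + t • X : ℝ⟦X⟧)⁻¹ * (1 + t • X) = 1 :=
      PowerSeries.inv_mul_cancel _ (by simp)
    have hsub : subNC U (1 + t • X : ℝ⟦X⟧) = 1 + t • U := by
      rw [subNC_add, subNC_one, subNC_smul, subNC_X hU0]
    have h2 : subNC U (1 + t • X : ℝ⟦X⟧)⁻¹ * (1 + t • U) = 1 := by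
      rw [← hsub, ← subNC_mul hU0, hinvt, subNC_one]
    have h3 : (1 + t • U) * subNC U (geomSeries t) = U := by
      rw [← hsub, ← subNC_mul hU0, one_add_mul_geomSeries, subNC_X hU0]
    have h4 : ∀ Z : A⟦X⟧, (1 + t • U) * Z = U → Z = subNC U (1 + t • X : ℝ⟦X⟧)⁻¹ * U := by
      intro Z hZ
      conv_rhs => enter [2]; rw [← hZ]
      rw [← mul_assoc, h2, one_mul]
    rw [h4 _ h3, ← h4 _ h1]

/-- If R majorizes both L and M, the four terms add up to (1 - t)cR + R + R + t cR = 2R + cR, the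
quantity bounded in `coeff_majorant_le_one`. -/
theorem norm_coeff_subNC_geomSeries_le {x y : A} {μ : ℝ} (hμ : 0 ≤ μ) (hx : ‖x‖ ≤ μ)
    (hy : ‖y‖ ≤ μ) {t : ℝ} (ht0 : 0 < t) (ht1 : t ≤ 1) {k : ℕ} (hk : 4 ≤ k) :
    ‖coeff k (subNC (expProdSubOne x y) (geomSeries t))‖ ≤ μ ^ k := by
  obtain ⟨L, M, hL, hM, hG⟩ := subNC_geomSeries_eq x y ht0.ne'
  have ha := isMajorant_subNC_blockSeries hx t
  have hb := isMajorant_subNC_blockSeries hy t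
  have hq : |-(t * (1 - t))| ≤ t * (1 - t) := by
    rw [abs_neg, abs_of_nonneg (mul_nonneg ht0.le (sub_nonneg.mpr ht1))]
  have hc0 : constantCoeff (absBlockSeries t * absBlockSeries t) = 0 := by
    simp [constantCoeff_absBlockSeries]
  have hL' : IsMajorant μ L (resolventMajorant t) :=
    IsMajorant.of_eq_add_smul_mul hq (by simp [constantCoeff_subNC, constantCoeff_blockSeries])
      hc0 hb (hb.mul ha) hL (resolventMajorant_eq t)
  have hM' : IsMajorant μ M (resolventMajorant t) :=
    IsMajorant.of_eq_add_smul_mul hq (by simp [constantCoeff_subNC, constantCoeff_blockSeries])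
      hc0 ha (ha.mul hb) hM (resolventMajorant_eq t)
  have h1 := (ha.mul hL') k
  have h2 := (hb.mul hM') k
  have hfin := mul_le_mul_of_nonneg_left (coeff_majorant_le_one ht0.le ht1 hk) (pow_nonneg hμ k)
  rw [hG, map_sub, map_add, map_add, coeff_algebra_smul, coeff_algebra_smul]
  refine (norm_sub_le _ _).trans ?_
  refine (add_le_add_left ((norm_add_le _ _).trans
    (add_le_add_left (norm_add_le _ _) _)) _).trans ?_
  rw [norm_smul, norm_smul, Real.norm_of_nonneg ht0.le, Real.norm_of_nonneg (sub_nonneg.mpr ht1)]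
  have h3 := mul_le_mul_of_nonneg_left h1 (sub_nonneg.mpr ht1)
  have h4 := mul_le_mul_of_nonneg_left h2 ht0.le
  have h5 := hL' k
  have h6 := hM' k
  nlinarith

theorem integral_coeff_subNC_geomSeries [CompleteSpace A] (x y : A) (k : ℕ) :
    ∫ t in (0 : ℝ)..1, coeff k (subNC (expProdSubOne x y) (geomSeries t)) =
      goldbergTerm ℝ x y k := by
  rw [goldbergTerm_eq_coeff]
  simp only [subNC, coeff_mk]
  rw [intervalIntegral.integral_finsetSum]
  · refine sum_congr rfl fun n _ => ?_
    rw [intervalIntegral.integral_smul_const, integral_coeff_geomSeries]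
  · intro n _
    exact ((continuous_coeff_geomSeries n).smul continuous_const).intervalIntegrable _ _

theorem norm_goldbergTerm_le_of_four_le [CompleteSpace A] {x y : A} {μ : ℝ} (hμ : 0 ≤ μ)
    (hx : ‖x‖ ≤ μ) (hy : ‖y‖ ≤ μ) {k : ℕ} (hk : 4 ≤ k) : ‖goldbergTerm ℝ x y k‖ ≤ μ ^ k := by
  rw [← integral_coeff_subNC_geomSeries]
  refine (intervalIntegral.norm_integral_le_of_norm_le_const (C := μ ^ k) fun t ht => ?_).trans
    (by simp)
  rw [Set.uIoc_of_le zero_le_one] at ht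
  exact norm_coeff_subNC_geomSeries_le hμ hx hy ht.1 ht.2 hk

end Resolvent

/-! ### Evaluation at T = 1 and the exponential identity -/

section Evaluation

variable {A : Type*} [NormedRing A]

theorem summable_norm_coeff_mul {R S : A⟦X⟧} (hR : Summable fun k => ‖coeff k R‖)
    (hS : Summable fun k => ‖coeff k S‖) : Summable fun k => ‖coeff k (R * S)‖ := by
  simp only [coeff_mul]
  exact summable_norm_sum_mul_antidiagonal_of_summable_norm
    (f := fun k => coeff k R) (g := fun k => coeff k S) hR hS

theorem tsum_coeff_mul [CompleteSpace A] {R S : A⟦X⟧} (hR : Summable fun k => ‖coeff k R‖)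
    (hS : Summable fun k => ‖coeff k S‖) :
    ∑' k, coeff k (R * S) = (∑' k, coeff k R) * ∑' k, coeff k S := by
  simp only [coeff_mul]
  exact (tsum_mul_tsum_eq_tsum_sum_antidiagonal_of_summable_norm hR hS).symm

theorem tsum_norm_coeff_mul_le {R S : A⟦X⟧} (hR : Summable fun k => ‖coeff k R‖)
    (hS : Summable fun k => ‖coeff k S‖) :
    ∑' k, ‖coeff k (R * S)‖ ≤ (∑' k, ‖coeff k R‖) * ∑' k, ‖coeff k S‖ := by
  have hR' : Summable fun k => ‖‖coeff k R‖‖ := by simpa using hR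
  have hS' : Summable fun k => ‖‖coeff k S‖‖ := by simpa using hS
  rw [tsum_mul_tsum_eq_tsum_sum_antidiagonal_of_summable_norm hR' hS']
  refine Summable.tsum_le_tsum (fun k => ?_) (summable_norm_coeff_mul hR hS)
    (summable_norm_sum_mul_antidiagonal_of_summable_norm hR' hS').of_norm
  rw [coeff_mul]
  exact norm_sum_le_of_le _ fun p _ => norm_mul_le _ _

theorem hasSum_coeff_one : HasSum (fun k => coeff k (1 : A⟦X⟧)) 1 := by
  simp only [coeff_one]
  exact hasSum_ite_eq 0 1

theorem hasSum_norm_coeff_one : HasSum (fun k => ‖coeff k (1 : A⟦X⟧)‖) ‖(1 : A)‖ := by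
  simp only [coeff_one, apply_ite norm, norm_zero]
  exact hasSum_ite_eq 0 _

theorem summable_norm_coeff_pow {R : A⟦X⟧} (hR : Summable fun k => ‖coeff k R‖) (n : ℕ) :
    Summable fun k => ‖coeff k (R ^ n)‖ := by
  induction n with
  | zero => rw [pow_zero]; exact hasSum_norm_coeff_one.summable
  | succ n ih => rw [pow_succ]; exact summable_norm_coeff_mul ih hR

theorem tsum_coeff_pow [CompleteSpace A] {R : A⟦X⟧} (hR : Summable fun k => ‖coeff k R‖) (n : ℕ) :
    ∑' k, coeff k (R ^ n) = (∑' k, coeff k R) ^ n := by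
  induction n with
  | zero => rw [pow_zero, pow_zero]; exact hasSum_coeff_one.tsum_eq
  | succ n ih => rw [pow_succ, pow_succ, tsum_coeff_mul (summable_norm_coeff_pow hR n) hR, ih]

theorem tsum_norm_coeff_pow_le {R : A⟦X⟧} (hR : Summable fun k => ‖coeff k R‖) (n : ℕ) :
    ∑' k, ‖coeff k (R ^ n)‖ ≤ ‖(1 : A)‖ * (∑' k, ‖coeff k R‖) ^ n := by
  induction n with
  | zero => rw [pow_zero, pow_zero, mul_one]; exact hasSum_norm_coeff_one.tsum_eq.le
  | succ n ih =>
    rw [pow_succ, pow_succ, ← mul_assoc]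
    exact (tsum_norm_coeff_mul_le (summable_norm_coeff_pow hR n) hR).trans
      (mul_le_mul_of_nonneg_right ih (tsum_nonneg fun _ => norm_nonneg _))

variable [NormedAlgebra ℝ A]

/-- The double series is dominated by ‖1‖ ∑ ρⁿ/n! with ρ = ∑ ‖R_k‖, so summation may be
interchanged; for fixed k only n ≤ k survive. -/
theorem exp_tsum_coeff [CompleteSpace A] {R : A⟦X⟧} (h0 : constantCoeff R = 0)
    (hR : Summable fun k => ‖coeff k R‖) :
    NormedSpace.exp (∑' k, coeff k R) =
      ∑' k, ∑ n ∈ range (k + 1), ((n.factorial : ℝ)⁻¹) • coeff k (R ^ n) := by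
  have hrow : ∀ n, Summable fun k => ‖((n.factorial : ℝ)⁻¹) • coeff k (R ^ n)‖ := fun n => by
    simp only [norm_smul]
    exact (summable_norm_coeff_pow hR n).mul_left _
  have hsum : Summable fun p : ℕ × ℕ => ((p.1.factorial : ℝ)⁻¹) • coeff p.2 (R ^ p.1) := by
    refine Summable.of_norm ((summable_prod_of_nonneg fun p => norm_nonneg _).mpr ⟨hrow, ?_⟩)
    refine Summable.of_nonneg_of_le (fun n => tsum_nonneg fun _ => norm_nonneg _) (fun n => ?_)
      ((Real.summable_pow_div_factorial (∑' k, ‖coeff k R‖)).mul_left ‖(1 : A)‖)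
    simp only [norm_smul]
    rw [tsum_mul_left, Real.norm_of_nonneg (by positivity), div_eq_inv_mul, mul_left_comm]
    exact mul_le_mul_of_nonneg_left (tsum_norm_coeff_pow_le hR n) (by positivity)
  rw [NormedSpace.exp_eq_tsum ℝ]
  simp only
  calc ∑' n : ℕ, ((n.factorial : ℝ)⁻¹) • (∑' k, coeff k R) ^ n
      = ∑' n : ℕ, ∑' k, ((n.factorial : ℝ)⁻¹) • coeff k (R ^ n) := by
        refine tsum_congr fun n => ?_
        rw [← tsum_coeff_pow hR n, (summable_norm_coeff_pow hR n).of_norm.tsum_const_smul]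
    _ = ∑' k, ∑' n : ℕ, ((n.factorial : ℝ)⁻¹) • coeff k (R ^ n) := hsum.tsum_comm.symm
    _ = _ := by
        refine tsum_congr fun k => tsum_eq_sum fun n hn => ?_
        rw [coeff_pow_eq_zero_of_lt h0 (by simpa using hn), smul_zero]

theorem sum_coeff_subNC_log_pow {U : A⟦X⟧} (hU : constantCoeff U = 0) (k : ℕ) :
    ∑ n ∈ range (k + 1), ((n.factorial : ℝ)⁻¹) • coeff k (subNC U (PowerSeries.log ℝ) ^ n) =
      coeff k (1 + U) := by
  have hpow : ∀ n, subNC U (PowerSeries.log ℝ) ^ n = subNC U (PowerSeries.log ℝ ^ n) := fun n =>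
    ((subHom ℝ U hU).map_pow _ n).symm
  have h1 : 1 + U = subNC U (1 + X : ℝ⟦X⟧) := by rw [subNC_add, subNC_one, subNC_X hU]
  simp only [hpow, h1]
  simp only [subNC, coeff_mk, smul_sum]
  rw [sum_comm]
  refine sum_congr rfl fun m hm => ?_
  simp only [smul_smul]
  rw [← sum_smul, sum_coeff_log_pow (mem_range.mp hm)]

theorem summable_norm_coeff_subNC_exp (x : A) :
    Summable fun k => ‖coeff k (subNC (C x * X) (PowerSeries.exp ℝ))‖ := by
  simp only [coeff_subNC_C_mul_X, coeff_exp]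
  simpa using NormedSpace.norm_expSeries_summable' (𝕂 := ℝ) x

theorem tsum_coeff_subNC_exp (x : A) :
    ∑' k, coeff k (subNC (C x * X) (PowerSeries.exp ℝ)) = NormedSpace.exp x := by
  rw [NormedSpace.exp_eq_tsum ℝ]
  simp [coeff_subNC_C_mul_X]

theorem exp_tsum_goldbergTerm [CompleteSpace A] {x y : A}
    (h : Summable fun k => ‖goldbergTerm ℝ x y k‖) :
    NormedSpace.exp (∑' k, goldbergTerm ℝ x y k) = NormedSpace.exp x * NormedSpace.exp y := by
  have hU := constantCoeff_expProdSubOne x y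
  simp only [goldbergTerm_eq_coeff] at h ⊢
  rw [exp_tsum_coeff (by simp [constantCoeff_subNC]) h]
  simp only [sum_coeff_subNC_log_pow hU]
  rw [expProdSubOne, add_sub_cancel, tsum_coeff_mul (summable_norm_coeff_subNC_exp x)
    (summable_norm_coeff_subNC_exp y), tsum_coeff_subNC_exp, tsum_coeff_subNC_exp]

end Evaluation

/-! ### Explicit terms of degree at most 3 and assembly -/

section Goldberg

variable {A : Type*} [NormedRing A]

theorem norm_commutator_le_of_le {a b : A} {α β : ℝ} (ha : ‖a‖ ≤ α) (hb : ‖b‖ ≤ β) :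
    ‖a * b - b * a‖ ≤ 2 * (α * β) := by
  have hα : 0 ≤ α := (norm_nonneg a).trans ha
  have hβ : 0 ≤ β := (norm_nonneg b).trans hb
  have h1 : ‖a * b‖ ≤ α * β := (norm_mul_le a b).trans (mul_le_mul ha hb (norm_nonneg _) hα)
  have h2 : ‖b * a‖ ≤ β * α := (norm_mul_le b a).trans (mul_le_mul hb ha (norm_nonneg _) hβ)
  linarith [norm_sub_le (a * b) (b * a)]

variable [NormedAlgebra ℝ A]

theorem goldbergTerm_zero (x y : A) : goldbergTerm ℝ x y 0 = 0 := by
  simp [goldbergTerm_eq_coeff, constantCoeff_subNC]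

theorem coeff_one_expProdSubOne (x y : A) : coeff 1 (expProdSubOne x y) = x + y := by
  simp [expProdSubOne, coeff_mul, Nat.antidiagonal_succ, coeff_subNC_C_mul_X, coeff_one, add_comm]

theorem goldbergTerm_one (x y : A) : goldbergTerm ℝ x y 1 = x + y := by
  rw [goldbergTerm_eq_coeff, subNC, coeff_mk]
  simp [sum_range_succ, coeff_one_expProdSubOne]

theorem coeff_two_expProdSubOne (x y : A) :
    coeff 2 (expProdSubOne x y) = (1 / 2 : ℝ) • (x * x) + x * y + (1 / 2 : ℝ) • (y * y) := by
  simp [expProdSubOne, coeff_mul, Nat.antidiagonal_succ, coeff_subNC_C_mul_X, coeff_one, sq]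
  abel

theorem coeff_three_expProdSubOne (x y : A) :
    coeff 3 (expProdSubOne x y) = (1 / 6 : ℝ) • (x * x * x) + (1 / 2 : ℝ) • (x * x * y) +
      (1 / 2 : ℝ) • (x * y * y) + (1 / 6 : ℝ) • (y * y * y) := by
  simp [expProdSubOne, coeff_mul, Nat.antidiagonal_succ, coeff_subNC_C_mul_X, coeff_one, pow_succ,
    Nat.factorial, mul_assoc]
  module

theorem goldbergTerm_two (x y : A) : goldbergTerm ℝ x y 2 = (1 / 2 : ℝ) • (x * y - y * x) := by
  have h0 : coeff 0 (expProdSubOne x y) = 0 := by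
    simpa using constantCoeff_expProdSubOne x y
  have h2 : coeff 2 (expProdSubOne x y ^ 2) = (x + y) * (x + y) := by
    rw [sq, coeff_mul]
    simp [Nat.antidiagonal_succ, h0, coeff_one_expProdSubOne, -coeff_zero_eq_constantCoeff]
  rw [goldbergTerm_eq_coeff, subNC, coeff_mk]
  simp only [sum_range_succ, range_zero, sum_empty, coeff_log, h2, pow_one,
    coeff_two_expProdSubOne]
  simp only [mul_add, add_mul]
  norm_num
  module

theorem goldbergTerm_three (x y : A) :
    goldbergTerm ℝ x y 3 = (1 / 12 : ℝ) • ((x * (x * y - y * x) - (x * y - y * x) * x) +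
      (y * (y * x - x * y) - (y * x - x * y) * y)) := by
  have h0 : coeff 0 (expProdSubOne x y) = 0 := by
    simpa using constantCoeff_expProdSubOne x y
  have h1 := coeff_one_expProdSubOne x y
  have h2 := coeff_two_expProdSubOne x y
  have h3 := coeff_three_expProdSubOne x y
  have hs1 : coeff 1 (expProdSubOne x y ^ 2) = 0 :=
    coeff_pow_eq_zero_of_lt (constantCoeff_expProdSubOne x y) (by norm_num)
  have hs0 : coeff 0 (expProdSubOne x y ^ 2) = 0 :=
    coeff_pow_eq_zero_of_lt (constantCoeff_expProdSubOne x y) (by norm_num)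
  have hs2 : coeff 2 (expProdSubOne x y ^ 2) = (x + y) * (x + y) := by
    rw [sq, coeff_mul]
    simp [Nat.antidiagonal_succ, h0, h1, -coeff_zero_eq_constantCoeff]
  have hs3 : coeff 3 (expProdSubOne x y ^ 2) =
      (x + y) * coeff 2 (expProdSubOne x y) + coeff 2 (expProdSubOne x y) * (x + y) := by
    rw [sq, coeff_mul]
    simp [Nat.antidiagonal_succ, h0, h1, -coeff_zero_eq_constantCoeff]
  have hc3 : coeff 3 (expProdSubOne x y ^ 3) = (x + y) * (x + y) * (x + y) := by
    rw [pow_succ, coeff_mul]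
    simp [Nat.antidiagonal_succ, h0, h1, hs0, hs1, hs2, -coeff_zero_eq_constantCoeff]
  rw [goldbergTerm_eq_coeff, subNC, coeff_mk]
  simp only [sum_range_succ, range_zero, sum_empty, coeff_log, hs3, hc3, pow_one, h2, h3]
  simp only [mul_add, add_mul, mul_sub, sub_mul, mul_smul_comm, smul_mul_assoc, mul_assoc]
  norm_num
  module

theorem norm_goldbergTerm_two_le {x y : A} {μ : ℝ} (hx : ‖x‖ ≤ μ) (hy : ‖y‖ ≤ μ) :
    ‖goldbergTerm ℝ x y 2‖ ≤ μ ^ 2 := by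
  rw [goldbergTerm_two, norm_smul, Real.norm_of_nonneg (by norm_num)]
  linarith [norm_commutator_le_of_le hx hy]

theorem norm_goldbergTerm_three_le {x y : A} {μ : ℝ} (hx : ‖x‖ ≤ μ) (hy : ‖y‖ ≤ μ) :
    ‖goldbergTerm ℝ x y 3‖ ≤ 2 / 3 * μ ^ 3 := by
  rw [goldbergTerm_three, norm_smul, Real.norm_of_nonneg (by norm_num)]
  have h1 := norm_commutator_le_of_le hx (norm_commutator_le_of_le hx hy)
  have h2 := norm_commutator_le_of_le hy (norm_commutator_le_of_le hy hx)
  linarith [norm_add_le (x * (x * y - y * x) - (x * y - y * x) * x)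
    (y * (y * x - x * y) - (y * x - x * y) * y)]

theorem norm_goldbergTerm_le [CompleteSpace A] {x y : A} {μ : ℝ} (hμ : 0 ≤ μ) (hx : ‖x‖ ≤ μ)
    (hy : ‖y‖ ≤ μ) {k : ℕ} (hk : 2 ≤ k) : ‖goldbergTerm ℝ x y k‖ ≤ μ ^ k := by
  obtain rfl | rfl | hk : k = 2 ∨ k = 3 ∨ 4 ≤ k := by omega
  · exact norm_goldbergTerm_two_le hx hy
  · have := pow_nonneg hμ 3
    exact (norm_goldbergTerm_three_le hx hy).trans (by linarith)
  · exact norm_goldbergTerm_le_of_four_le hμ hx hy hk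

theorem goldbergSeries_eq_tsum {x y : A} (h : Summable fun k => goldbergTerm ℝ x y k) :
    goldbergSeries ℝ x y = ∑' k, goldbergTerm ℝ x y k := by
  rw [goldbergSeries, ← h.sum_add_tsum_nat_add 2]
  simp [sum_range_succ, goldbergTerm_zero, goldbergTerm_one]

theorem goldbergTerm_eq_real (𝕜 : Type*) [RCLike 𝕜] [NormedAlgebra 𝕜 A] [IsScalarTower ℝ 𝕜 A]
    (x y : A) (k : ℕ) : goldbergTerm 𝕜 x y k = goldbergTerm ℝ x y k := by
  refine sum_congr rfl fun w _ => ?_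
  generalize goldbergCoeff (List.ofFn w) = g
  rw [← algebraMap_smul 𝕜 (g : ℝ)]
  simp

end Goldberg

end

theorem lemmaA1 {𝕜 A : Type*} [RCLike 𝕜] [NormedRing A] [NormedAlgebra 𝕜 A] [CompleteSpace A]
    (X Y : A) (μ : ℝ) (hμ₀ : 0 < μ) (hμ₁ : μ < 1) (hX : ‖X‖ ≤ μ) (hY : ‖Y‖ ≤ μ) :
    (∀ k : ℕ, 2 ≤ k → ‖goldbergTerm 𝕜 X Y k‖ ≤ μ ^ k) ∧
    Summable (fun k : ℕ => ‖goldbergTerm 𝕜 X Y (k + 2)‖) ∧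
    NormedSpace.exp X * NormedSpace.exp Y = NormedSpace.exp (goldbergSeries 𝕜 X Y) ∧
    ‖goldbergSeries 𝕜 X Y‖ < ‖X‖ + ‖Y‖ + ∑' k : ℕ, μ ^ (k + 2) := by
  let _ : NormedAlgebra ℝ A := NormedAlgebra.restrictScalars ℝ 𝕜 A
  have : IsScalarTower ℝ 𝕜 A := RestrictScalars.isScalarTower ℝ 𝕜 A
  have hterm : ∀ k, goldbergTerm 𝕜 X Y k = goldbergTerm ℝ X Y k := goldbergTerm_eq_real 𝕜 X Y
  have hseries : goldbergSeries 𝕜 X Y = goldbergSeries ℝ X Y := by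
    simp only [goldbergSeries, hterm]
  simp only [hterm, hseries]
  have hbound : ∀ k : ℕ, 2 ≤ k → ‖goldbergTerm ℝ X Y k‖ ≤ μ ^ k := fun k hk =>
    norm_goldbergTerm_le hμ₀.le hX hY hk
  have hgeom : Summable fun k : ℕ => μ ^ (k + 2) :=
    (summable_nat_add_iff 2).mpr (summable_geometric_of_lt_one hμ₀.le hμ₁)
  have hsum : Summable fun k : ℕ => ‖goldbergTerm ℝ X Y (k + 2)‖ :=
    hgeom.of_nonneg_of_le (fun _ => norm_nonneg _) fun k => hbound _ (by omega)
  have hsum' : Summable fun k : ℕ => ‖goldbergTerm ℝ X Y k‖ :=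
    (summable_nat_add_iff (f := fun k : ℕ => ‖goldbergTerm ℝ X Y k‖) 2).mp hsum
  refine ⟨hbound, hsum, ?_, ?_⟩
  · rw [goldbergSeries_eq_tsum hsum'.of_norm, exp_tsum_goldbergTerm hsum']
  · rw [goldbergSeries]
    refine (norm_add_le _ _).trans_lt (add_lt_add_of_le_of_lt (norm_add_le _ _) ?_)
    refine (norm_tsum_le_tsum_norm hsum).trans_lt
      -- Index 1 is degree 3, where the bound (2/3)μ³ is strictly below μ³.
      (Summable.tsum_lt_tsum (i := 1) (fun k => hbound _ (by omega)) ?_ hsum hgeom)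
    have h3 := norm_goldbergTerm_three_le (A := A) hX hY
    have := pow_pos hμ₀ 3
    exact h3.trans_lt (by norm_num; linarith)
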